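/- Let $X$ be a (finite) real random variable with law $\mu$ and $P[X<0]=0$. Given i.i.d. random variables $X_2,X_3,\dots$ distributed as $X$ and an almost surely nonnegative random variable $W_1$ on the same probability space, let $W_{n+1}=\max\{0,X_{n+1}-W_n\}$ for $n\ge 1$. A stationary law of the recursion is a probability measure $\pi$ on $\mathbb R$ such that $W\stackrel{d}{=}\max\{0,X-W\}$ whenever $W\sim\pi$ is independent of $X$. (a) A stationary law exists. Moreover, for every initial state $W_1$ the family of laws of $W_n$, $n\ge1$, is tight. (b) Assume in addition that $X$ is non-deterministic (not almost surely equal to a constant). Then the stationary law $\pi$ is unique, and there are constants $C>0$ and $\rho\in(0,1)$, depending only on $\mu$, such that for every probability space carrying such $(X_i)$, every initial state $W_1$, and every $m\ge 1$, $$\sup_{A\text{ Borel}}\bigl|P[W_m\in A]-\pi(A)\bigr|\le C\rho^m .$$ (c) Still for non-deterministic $X$: there exist $n\ge1$ and $\epsilon>0$ with $P[X\ge(n+1)\epsilon]>0$ and $P[X\le n\epsilon]>0$. For every such pair $(n,\epsilon)$ let $$E_{n,i}=\{X_i\le n\epsilon;\ X_{i+1}\ge(n+1)\epsilon;\ X_{i+2}\le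 n\epsilon;\ \dots;\ X_{i+2n-1}\ge(n+1)\epsilon;\ X_{i+2n}\le n\epsilon\}\qquad(i\ge2),$$ $q=P[X\ge(n+1)\epsilon]^n\,P[X\le n\epsilon]^{n+1}$, $\tau_{E_n}=\inf\{\ell\ge2: E_{n,\ell}\text{ occurs}\}$ (with $\inf\emptyset=\infty$) and $\tau=\tau_{E_n}+2n$. Then $P[E_{n,i}]=q>0$ for all $i\ge2$; $P[\tau_{E_n}\ge(2n+1)k]\le(2n+1)(1-q)^k$ for all $k\ge1$; and $\tau<\infty$ almost surely. If $(W_m)$ and $(W'_m)$ satisfy the recursion with the same $(X_i)$ and arbitrary almost surely nonnegative initial states $W_1,W_1'$, then almost surely $W_\tau=W'_\tau=0$ and $W_m=W'_m$ for all $m\ge\tau$. Consequently, for every initial state and all $m\ge1$, $$\sup_{A\text{ Borel}}\bigl|P[W_m\in A]-\pi(A)\bigr|\le P[\tau>m].$$ -/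

import Mathlib

open MeasureTheory ProbabilityTheory Set

universe u

/-- `π` is a stationary (equilibrium) law of the recursion `W_{n+1} = max {0, X_{n+1} - W_n}` when
`X` has law `μ`: a probability measure such that if `W ∼ π` and `X ∼ μ` are independent,
then `max {0, X - W} ∼ π`. -/
structure IsStationaryLaw (μ π : Measure ℝ) : Prop where
  isProbabilityMeasure : IsProbabilityMeasure π
  map_eq : (π.prod μ).map (fun p : ℝ × ℝ => max 0 (p.2 - p.1)) = π

/-- `X_2, X_3, …` are independent real random variables with common law `μ`.
(The entries `X 0` and `X 1` are never used.) -/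
structure IsIIDInput {Ω : Type*} [MeasurableSpace Ω] (P : Measure Ω) (μ : Measure ℝ)
    (X : ℕ → Ω → ℝ) : Prop where
  measurable : ∀ i, 2 ≤ i → Measurable (X i)
  law : ∀ i, 2 ≤ i → P.map (X i) = μ
  indep : iIndepFun (fun i : ℕ => X (i + 2)) P

/-- `W_1, W_2, …` is a waiting-time process driven by `X_2, X_3, …`: the initial state `W_1` is an
arbitrary almost surely nonnegative random variable, and `W_{n+1} = max {0, X_{n+1} - W_n}` for all
`n ≥ 1`. (The entry `W 0` is never used.) -/
structure IsWaitingProcess {Ω : Type*} [MeasurableSpace Ω] (P : Measure Ω)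
    (X W : ℕ → Ω → ℝ) : Prop where
  measurable_init : Measurable (W 1)
  nonneg_init : ∀ᵐ ω ∂P, 0 ≤ W 1 ω
  recursion : ∀ n, 1 ≤ n → ∀ ω, W (n + 1) ω = max 0 (X (n + 1) ω - W n ω)

/-- The pairs `(n, ε)` with `n ≥ 1`, `ε > 0`, `P[X ≥ (n+1)ε] > 0` and `P[X ≤ nε] > 0`, where `X` has
law `μ`. -/
structure IsAdmissible (μ : Measure ℝ) (n : ℕ) (ε : ℝ) : Prop where
  one_le : 1 ≤ n
  pos : 0 < ε
  upper : 0 < μ (Ici (((n : ℝ) + 1) * ε))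
  lower : 0 < μ (Iic ((n : ℝ) * ε))

/-- The event `E_{n,i} = {X_i ≤ nε; X_{i+1} ≥ (n+1)ε; X_{i+2} ≤ nε; …; X_{i+2n-1} ≥ (n+1)ε;
X_{i+2n} ≤ nε}`. -/
def alternatingEvent {Ω : Type*} (X : ℕ → Ω → ℝ) (n : ℕ) (ε : ℝ) (i : ℕ) : Set Ω :=
  {ω | (∀ k, k ≤ n → X (i + 2 * k) ω ≤ (n : ℝ) * ε) ∧
    (∀ k, k < n → ((n : ℝ) + 1) * ε ≤ X (i + 2 * k + 1) ω)}

/-- The number `q = P[X ≥ (n+1)ε]^n P[X ≤ nε]^{n+1}`, where `X` has law `μ`. -/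
noncomputable def alternatingProb (μ : Measure ℝ) (n : ℕ) (ε : ℝ) : ℝ :=
  μ.real (Ici (((n : ℝ) + 1) * ε)) ^ n * μ.real (Iic ((n : ℝ) * ε)) ^ (n + 1)

/-- The hitting time `inf {ℓ ≥ 2 : E_{n,ℓ} occurs}`, equal to `∞` if no such event occurs. -/
noncomputable def hittingTimeE {Ω : Type*} (X : ℕ → Ω → ℝ) (n : ℕ) (ε : ℝ) (ω : Ω) : ℕ∞ :=
  ⨅ (ℓ : ℕ) (_ : 2 ≤ ℓ ∧ ω ∈ alternatingEvent X n ε ℓ), (ℓ : ℕ∞)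

/-- The coupling time `τ_{E_n} + 2n`. -/
noncomputable def couplingTime {Ω : Type*} (X : ℕ → Ω → ℝ) (n : ℕ) (ε : ℝ) (ω : Ω) : ℕ∞ :=
  hittingTimeE X n ε ω + ((2 * n : ℕ) : ℕ∞)

/-! An alternating block of `2n+1` inputs forgets the past: a low input brings any nonnegative state
to at most `nε`, each following high-low pair lowers that bound by `ε`, and after `n` pairs the
state is `0` (`eq_zero_of_alternating`). Two distinct points of the support of `μ` supply such
blocks with positive probability (`exists_isAdmissible`), and disjoint blocks are independent, so
the waiting time for one has a geometric tail.

Run backwards, the iterations from `0` are almost surely eventually constant, and their limit has a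
stationary law. Run forwards, a process with arbitrary start and one started from `π` with the same
inputs agree from the coupling time on; this gives `IsStationaryLaw.abs_sub_le`, hence the rate and
uniqueness. Tightness needs only `0 ≤ W (m+1) ≤ X (m+1)`. -/

/-! ### Shifts of i.i.d. sequences -/

/-- The law of an i.i.d. sequence with marginal `μ`. -/
noncomputable abbrev iidLaw (μ : Measure ℝ) : Measure (ℕ → ℝ) := Measure.infinitePi fun _ => μ

/-- Dropping the first `N` entries of a sequence. -/
def dropSeq (N : ℕ) (x : ℕ → ℝ) : ℕ → ℝ := fun i => x (i + N)

@[fun_prop]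
lemma measurable_dropSeq (N : ℕ) : Measurable (dropSeq N) := by
  unfold dropSeq; fun_prop

lemma measurePreserving_dropSeq (μ : Measure ℝ) [IsProbabilityMeasure μ] (N : ℕ) :
    MeasurePreserving (dropSeq N) (iidLaw μ) (iidLaw μ) where
  measurable := measurable_dropSeq N
  map_eq := by
    have h : iIndepFun (fun (i : ℕ) (x : ℕ → ℝ) => x i) (iidLaw μ) :=
      iIndepFun_infinitePi (X := fun _ x => x) fun _ => measurable_id
    have h2 := h.precomp (add_left_injective N)
    have h3 := h2.map_fun_eq_infinitePi_map (fun i => measurable_pi_apply _)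
    simp only [Measure.infinitePi_map_eval] at h3
    exact h3

lemma indepFun_take_dropSeq (μ : Measure ℝ) [IsProbabilityMeasure μ] (N : ℕ) :
    IndepFun (fun (x : ℕ → ℝ) (i : Fin N) => x i) (dropSeq N) (iidLaw μ) := by
  have h : iIndepFun (fun (i : ℕ) (x : ℕ → ℝ) => x i) (iidLaw μ) :=
    iIndepFun_infinitePi (X := fun _ x => x) fun _ => measurable_id
  have hd : Disjoint (Iio N) (Ici N) :=
    Set.disjoint_left.2 fun i hi hi' => absurd (mem_Iio.1 hi) (not_lt.2 (mem_Ici.1 hi'))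
  have := indep_iSup_of_disjoint (fun i => (measurable_pi_apply i).comap_le) h.iIndep hd
  rw [IndepFun_iff_Indep]
  refine indep_of_indep_of_le_left (indep_of_indep_of_le_right this ?_) ?_
  · rw [← measurable_iff_comap_le]
    refine (@measurable_pi_iff _ _ _ (_) _ _).2 ?_
    intro i
    rw [measurable_iff_comap_le]
    exact le_iSup₂_of_le (i + N) (by simp) le_rfl
  · rw [← measurable_iff_comap_le]
    refine (@measurable_pi_iff _ _ _ (_) _ _).2 ?_
    intro i
    rw [measurable_iff_comap_le]
    exact le_iSup₂_of_le (i : ℕ) (by simp) le_rfl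

/-- Separates the input of one step from all the others; both the existence and the invariance of
stationary laws rest on it. -/
lemma measurePreserving_dropSeq_one_prodMk (μ : Measure ℝ) [IsProbabilityMeasure μ] :
    MeasurePreserving (fun x : ℕ → ℝ => (dropSeq 1 x, x 0)) (iidLaw μ) ((iidLaw μ).prod μ) where
  measurable := by fun_prop
  map_eq := by
    have h0 : Measurable fun y : Fin 1 → ℝ => y 0 := by fun_prop
    have h := ((indepFun_take_dropSeq μ 1).comp h0 measurable_id).symm
    have h2 := h.map_prod_eq_prod_map_map (by fun_prop)
      (h0.comp (by fun_prop)).aemeasurable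
    simp only [Function.comp_def, id_eq, (measurePreserving_dropSeq μ 1).map_eq] at h2
    rw [Measure.infinitePi_map_eval] at h2
    exact h2

/-- The input entries `X_2, X_3, …` as one random sequence. -/
def inputSeq {Ω : Type*} (X : ℕ → Ω → ℝ) (ω : Ω) : ℕ → ℝ := fun i => X (i + 2) ω

lemma IsIIDInput.measurePreserving {Ω : Type*} [MeasurableSpace Ω] {P : Measure Ω}
    {μ : Measure ℝ} {X : ℕ → Ω → ℝ} (h : IsIIDInput P μ X) :
    MeasurePreserving (inputSeq X) P (iidLaw μ) where
  measurable := measurable_pi_iff.2 fun i => h.measurable _ (by omega)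
  map_eq := by
    have h3 := h.indep.map_fun_eq_infinitePi_map (fun i => h.measurable _ (by omega))
    simp only [fun i : ℕ => h.law (i + 2) (by omega)] at h3
    exact h3

lemma isIIDInput_iidLaw (μ : Measure ℝ) [IsProbabilityMeasure μ] :
    IsIIDInput (iidLaw μ) μ (fun i x => x (i - 2)) where
  measurable _ _ := measurable_pi_apply _
  law _ _ := Measure.infinitePi_map_eval _ _
  indep := iIndepFun_infinitePi (X := fun _ x => x) fun _ => measurable_id

/-! ### Forward and backward iterations of the recursion -/

/-- The state reached from `w` after `m` steps driven by `x 0, …, x (m - 1)`. -/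
noncomputable def forwardIter : ℕ → (ℕ → ℝ) → ℝ → ℝ
  | 0, _, w => w
  | m + 1, x, w => forwardIter m (dropSeq 1 x) (max 0 (x 0 - w))

/-- The state reached from `0` after `m` steps driven by `x (m - 1), …, x 0`. -/
noncomputable def backwardIter : ℕ → (ℕ → ℝ) → ℝ
  | 0, _ => 0
  | m + 1, x => max 0 (x 0 - backwardIter m (dropSeq 1 x))

lemma backwardIter_succ (m : ℕ) (x : ℕ → ℝ) :
    backwardIter (m + 1) x = max 0 (x 0 - backwardIter m (dropSeq 1 x)) := rfl

lemma dropSeq_dropSeq (M N : ℕ) (x : ℕ → ℝ) : dropSeq M (dropSeq N x) = dropSeq (M + N) x := by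
  funext i; simp [dropSeq, add_assoc]

/-- The definition peels off the first input, which suits induction along the shift; peeling off the
last one matches the recursion for `W`. -/
lemma forwardIter_succ (m : ℕ) (x : ℕ → ℝ) (w : ℝ) :
    forwardIter (m + 1) x w = max 0 (x m - forwardIter m x w) := by
  induction m generalizing x w with
  | zero => rfl
  | succ m ih => rw [forwardIter, ih]; rfl

lemma measurable_forwardIter (m : ℕ) :
    Measurable (fun p : (ℕ → ℝ) × ℝ => forwardIter m p.1 p.2) := by
  induction m with
  | zero => exact measurable_snd
  | succ m ih => simp only [forwardIter_succ]; fun_prop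

@[fun_prop]
lemma measurable_backwardIter (m : ℕ) : Measurable (backwardIter m) := by
  induction m with
  | zero => exact measurable_const
  | succ m ih => simp only [funext (backwardIter_succ m)]; fun_prop

lemma backwardIter_nonneg (m : ℕ) (x : ℕ → ℝ) : 0 ≤ backwardIter m x := by
  cases m with
  | zero => exact le_rfl
  | succ m => exact le_max_left _ _

/-- The inputs `x (i - 1), …, x 0` act last, so they preserve any agreement reached before them. -/
lemma backwardIter_add_congr (i : ℕ) {r s : ℕ} {x : ℕ → ℝ}
    (h : backwardIter r (dropSeq i x) = backwardIter s (dropSeq i x)) :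
    backwardIter (r + i) x = backwardIter (s + i) x := by
  induction i generalizing x with
  | zero => exact h
  | succ i ih =>
    rw [← add_assoc, ← add_assoc, backwardIter_succ, backwardIter_succ,
      ih (by rwa [dropSeq_dropSeq])]

lemma IsWaitingProcess.eq_forwardIter {Ω : Type*} [MeasurableSpace Ω] {P : Measure Ω}
    {X W : ℕ → Ω → ℝ} (h : IsWaitingProcess P X W) (m : ℕ) (ω : Ω) :
    W (m + 1) ω = forwardIter m (inputSeq X ω) (W 1 ω) := by
  induction m with
  | zero => rfl
  | succ m ih => rw [forwardIter_succ, ← ih, h.recursion (m + 1) (by omega)]; rfl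

lemma IsWaitingProcess.measurable {Ω : Type*} [MeasurableSpace Ω] {P : Measure Ω} {μ : Measure ℝ}
    {X W : ℕ → Ω → ℝ} (h : IsWaitingProcess P X W) (hX : IsIIDInput P μ X) {m : ℕ} (hm : 1 ≤ m) :
    Measurable (W m) := by
  obtain ⟨m, rfl⟩ := Nat.exists_eq_add_of_le' hm
  rw [funext (h.eq_forwardIter m)]
  exact (measurable_forwardIter m).comp
    (hX.measurePreserving.measurable.prodMk h.measurable_init)

lemma IsWaitingProcess.nonneg {Ω : Type*} [MeasurableSpace Ω] {P : Measure Ω}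
    {X W : ℕ → Ω → ℝ} (h : IsWaitingProcess P X W) {ω : Ω} (h1 : 0 ≤ W 1 ω) {m : ℕ} (hm : 1 ≤ m) :
    0 ≤ W m ω := by
  obtain ⟨m, rfl⟩ := Nat.exists_eq_add_of_le' hm
  cases m with
  | zero => exact h1
  | succ m => rw [h.recursion _ (by omega)]; exact le_max_left _ _

/-! ### Alternating blocks reset the recursion -/

/-- Steps of the recursion driven by low and high inputs in alternation, `n + 1` low ones
and `n` high ones, lead from any nonnegative state to `0`. -/
lemma eq_zero_of_alternating {n : ℕ} {ε : ℝ} (hε : 0 < ε) {u y : ℕ → ℝ} (h0 : 0 ≤ u 0)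
    (hu : ∀ j ≤ 2 * n, u (j + 1) = max 0 (y j - u j))
    (hlow : ∀ k ≤ n, y (2 * k) ≤ n * ε) (hhigh : ∀ k < n, (n + 1) * ε ≤ y (2 * k + 1)) :
    u (2 * n + 1) = 0 := by
  -- If `u ≤ (n - k)ε`, a high input gives a state at least `(k + 1)ε`, and the next low input one
  -- at most `(n - k - 1)ε`.
  have key : ∀ k ≤ n, u (2 * k + 1) ≤ (n - k) * ε := by
    intro k
    induction k with
    | zero =>
      intro _
      have := hlow 0 (by omega)
      rw [hu _ (by omega)]
      refine max_le (by simp; positivity) ?_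
      simp only [mul_zero, Nat.cast_zero] at *
      linarith
    | succ k ih =>
      intro hk
      have h1 := ih (by omega)
      have h2 := hlow (k + 1) hk
      have h3 := hhigh k hk
      have h4 : (u (2 * k + 2)) = _ := hu (2 * k + 1) (by omega)
      have h5 : u (2 * (k + 1) + 1) = max 0 (y (2 * (k + 1)) - u (2 * k + 2)) :=
        hu (2 * k + 2) (by omega)
      have h6 : y (2 * k + 1) - u (2 * k + 1) ≤ u (2 * k + 2) := h4 ▸ le_max_right _ _
      have h7 : (k : ℝ) + 1 ≤ n := by exact_mod_cast hk
      rw [h5]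
      push_cast
      refine max_le (mul_nonneg (by linarith) hε.le) ?_
      linarith
  refine le_antisymm ((key n le_rfl).trans (by simp)) ?_
  rw [hu _ le_rfl]
  exact le_max_left _ _

lemma mem_alternatingEvent_add_two {Ω : Type*} {X : ℕ → Ω → ℝ} {n : ℕ} {ε : ℝ} {i : ℕ} {ω : Ω} :
    ω ∈ alternatingEvent X n ε (i + 2) ↔
      inputSeq X ω ∈ alternatingEvent (fun j x => x j) n ε i := by
  have h1 : ∀ k, i + 2 + 2 * k = i + 2 * k + 2 := fun k => by omega
  have h2 : ∀ k, i + 2 * k + 2 + 1 = i + 2 * k + 1 + 2 := fun k => by omega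
  simp only [alternatingEvent, mem_ofPred_eq, inputSeq, h1, h2]

lemma IsWaitingProcess.eq_zero_of_alternating {Ω : Type*} [MeasurableSpace Ω] {P : Measure Ω}
    {X W : ℕ → Ω → ℝ} (h : IsWaitingProcess P X W) {n : ℕ} {ε : ℝ} (hε : 0 < ε) {i : ℕ}
    (hi : 2 ≤ i) {ω : Ω} (h1 : 0 ≤ W 1 ω) (hE : ω ∈ alternatingEvent X n ε i) :
    W (i + 2 * n) ω = 0 := by
  obtain ⟨i, rfl⟩ := Nat.exists_eq_add_of_le' hi
  have := _root_.eq_zero_of_alternating (n := n) hε (u := fun j => W (i + 1 + j) ω)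
    (y := fun j => X (i + 2 + j) ω) (h.nonneg h1 (by omega))
    (fun j _ => by
      have h2 : i + 2 + j = i + 1 + j + 1 := by omega
      simp only [h2]
      exact h.recursion (i + 1 + j) (by omega) ω) hE.1 hE.2
  rwa [show i + 2 + 2 * n = i + 1 + (2 * n + 1) by omega]

/-- The alternating pattern is a palindrome, so it also resets the state when read backwards: inputs
beyond the block at `i` have no influence. -/
lemma backwardIter_eq_of_alternating {n : ℕ} {ε : ℝ} (hε : 0 < ε) {i m : ℕ} {x : ℕ → ℝ}
    (hx : x ∈ alternatingEvent (fun j x => x j) n ε i) (hm : i + (2 * n + 1) ≤ m) :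
    backwardIter m x = backwardIter i x := by
  obtain ⟨r, rfl⟩ := Nat.exists_eq_add_of_le' hm
  have h := eq_zero_of_alternating (n := n) hε
    (u := fun j => backwardIter (r + j) (dropSeq (2 * n + 1 - j + i) x))
    (y := fun j => x (2 * n - j + i)) (backwardIter_nonneg _ _)
    (fun j hj => by
      simp only [← add_assoc, backwardIter_succ, dropSeq_dropSeq]
      rw [show 2 * n + 1 - (j + 1) + i = 2 * n - j + i by omega,
        show 1 + (2 * n + 1 - (j + 1)) + i = 2 * n + 1 - j + i by omega]
      simp [dropSeq])
    (fun k hk => by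
      have := hx.1 (n - k) (by omega)
      rwa [show i + 2 * (n - k) = 2 * n - 2 * k + i by omega] at this)
    (fun k hk => by
      have := hx.2 (n - k - 1) (by omega)
      rwa [show i + 2 * (n - k - 1) + 1 = 2 * n - (2 * k + 1) + i by omega] at this)
  simp only [Nat.sub_self, zero_add] at h
  -- The value `0` after the block is read as the backward iteration of length `0`.
  have := backwardIter_add_congr i (s := 0) (h.trans rfl)
  rw [zero_add] at this
  rwa [show r + (i + (2 * n + 1)) = r + (2 * n + 1) + i by omega]

/-! ### The hitting time of the alternating event -/

lemma hittingTimeE_le_iff {Ω : Type*} {X : ℕ → Ω → ℝ} {n : ℕ} {ε : ℝ} {ω : Ω} {m : ℕ} :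
    hittingTimeE X n ε ω ≤ m ↔ ∃ ℓ, 2 ≤ ℓ ∧ ℓ ≤ m ∧ ω ∈ alternatingEvent X n ε ℓ := by
  constructor
  · intro h
    by_contra! hc
    have : ((m + 1 : ℕ) : ℕ∞) ≤ hittingTimeE X n ε ω := by
      refine le_iInf₂ fun ℓ hℓ => ?_
      by_contra! hlt
      exact hc ℓ hℓ.1 (Nat.lt_succ_iff.1 (by exact_mod_cast hlt)) hℓ.2
    have h2 := this.trans h
    norm_cast at h2
    omega
  · rintro ⟨ℓ, h2, hm, hE⟩
    exact (iInf₂_le ℓ ⟨h2, hE⟩).trans (by exact_mod_cast hm)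

lemma couplingTime_le_iff {Ω : Type*} {X : ℕ → Ω → ℝ} {n : ℕ} {ε : ℝ} {ω : Ω} {m : ℕ} :
    couplingTime X n ε ω ≤ m ↔ ∃ ℓ, 2 ≤ ℓ ∧ ℓ + 2 * n ≤ m ∧ ω ∈ alternatingEvent X n ε ℓ := by
  constructor
  · intro h
    have h1 : hittingTimeE X n ε ω ≠ ⊤ := by
      intro ht
      simp [couplingTime, ht] at h
    obtain ⟨k, hk⟩ := ENat.ne_top_iff_exists.1 h1
    obtain ⟨ℓ, h2, hℓ, hE⟩ := hittingTimeE_le_iff.1 hk.ge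
    refine ⟨ℓ, h2, ?_, hE⟩
    rw [couplingTime, ← hk] at h
    norm_cast at h
    omega
  · rintro ⟨ℓ, h2, hm, hE⟩
    calc couplingTime X n ε ω ≤ (ℓ : ℕ∞) + ((2 * n : ℕ) : ℕ∞) := by
          unfold couplingTime
          gcongr
          exact hittingTimeE_le_iff.2 ⟨ℓ, h2, le_rfl, hE⟩
      _ ≤ m := by exact_mod_cast hm

lemma IsWaitingProcess.eq_zero_of_couplingTime_eq {Ω : Type*} [MeasurableSpace Ω] {P : Measure Ω}
    {X W : ℕ → Ω → ℝ} (h : IsWaitingProcess P X W) {n : ℕ} {ε : ℝ} (hε : 0 < ε)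
    {ω : Ω} (h1 : 0 ≤ W 1 ω) {m : ℕ} (hm : couplingTime X n ε ω = m) : W m ω = 0 := by
  obtain ⟨ℓ, h2, hℓ, hE⟩ := couplingTime_le_iff.1 hm.le
  have : m ≤ ℓ + 2 * n := by
    have := couplingTime_le_iff.2 ⟨ℓ, h2, le_rfl, hE⟩
    rw [hm] at this
    exact_mod_cast this
  rw [show m = ℓ + 2 * n by omega]
  exact h.eq_zero_of_alternating hε h2 h1 hE

/-- Stated for two numbers as starts, so that it also applies to a start of law `π` living on
another factor of a product space. -/
lemma forwardIter_eq_of_couplingTime_le {Ω : Type*} {X : ℕ → Ω → ℝ} {n : ℕ} {ε : ℝ} (hε : 0 < ε)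
    {ω : Ω} {w w' : ℝ} (hw : 0 ≤ w) (hw' : 0 ≤ w') {m : ℕ} (hm : couplingTime X n ε ω ≤ m) :
    forwardIter (m - 1) (inputSeq X ω) w = forwardIter (m - 1) (inputSeq X ω) w' := by
  obtain ⟨ℓ, h2, hℓ, hE⟩ := couplingTime_le_iff.1 hm
  obtain ⟨i, rfl⟩ := Nat.exists_eq_add_of_le' h2
  have hz : ∀ w, 0 ≤ w → forwardIter (i + (2 * n + 1)) (inputSeq X ω) w = 0 := by
    intro w hw
    refine eq_zero_of_alternating (n := n) hε
      (u := fun j => forwardIter (i + j) (inputSeq X ω) w)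
      (y := fun j => inputSeq X ω (i + j)) ?_ (fun j _ => forwardIter_succ _ _ _) ?_ ?_
    · cases i with
      | zero => exact hw
      | succ i => rw [add_zero, forwardIter_succ]; exact le_max_left _ _
    · exact (mem_alternatingEvent_add_two.1 hE).1
    · exact (mem_alternatingEvent_add_two.1 hE).2
  obtain ⟨d, hd⟩ := Nat.exists_eq_add_of_le (show i + (2 * n + 1) ≤ m - 1 by omega)
  rw [hd]
  clear hd
  induction d with
  | zero => simp only [add_zero, hz w hw, hz w' hw']
  | succ d ih => rw [← add_assoc, forwardIter_succ, forwardIter_succ, ih]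

lemma IsWaitingProcess.eq_of_couplingTime_le {Ω : Type*} [MeasurableSpace Ω] {P : Measure Ω}
    {X W W' : ℕ → Ω → ℝ} (h : IsWaitingProcess P X W) (h' : IsWaitingProcess P X W')
    {n : ℕ} {ε : ℝ} (hε : 0 < ε) {ω : Ω} (h1 : 0 ≤ W 1 ω) (h1' : 0 ≤ W' 1 ω) {m : ℕ}
    (hm : couplingTime X n ε ω ≤ m) : W m ω = W' m ω := by
  have hm1 : 1 ≤ m := by
    obtain ⟨ℓ, h2, hℓ, -⟩ := couplingTime_le_iff.1 hm
    omega
  have := forwardIter_eq_of_couplingTime_le hε h1 h1' hm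
  rwa [← h.eq_forwardIter, ← h'.eq_forwardIter, Nat.sub_add_cancel hm1] at this

/-! ### Probability and hitting time of the alternating event -/

/-- One constraint per coordinate, chosen by parity: the form that independence applies to. -/
lemma alternatingEvent_eq_biInter {Ω : Type*} (X : ℕ → Ω → ℝ) (n : ℕ) (ε : ℝ) (i : ℕ) :
    alternatingEvent X n ε i = ⋂ j ∈ Finset.range (2 * n + 1),
      (X (i + j)) ⁻¹' (if Even j then Iic (n * ε) else Ici ((n + 1) * ε)) := by
  ext ω
  simp only [alternatingEvent, mem_ofPred_eq, mem_iInter, Finset.mem_range, mem_preimage]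
  constructor
  · rintro ⟨h1, h2⟩ j hj
    obtain ⟨k, rfl⟩ | ⟨k, rfl⟩ := Nat.even_or_odd j
    · rw [if_pos ⟨k, rfl⟩, ← two_mul]
      exact h1 k (by omega)
    · rw [if_neg (by simp)]
      exact h2 k (by omega)
  · intro h
    refine ⟨fun k hk => ?_, fun k hk => ?_⟩
    · simpa using h (2 * k) (by omega)
    · simpa [add_assoc] using h (2 * k + 1) (by omega)

lemma measurableSet_alternatingEvent (n : ℕ) (ε : ℝ) (i : ℕ) :
    MeasurableSet (alternatingEvent (fun j (x : ℕ → ℝ) => x j) n ε i) := by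
  rw [alternatingEvent_eq_biInter]
  refine Finset.measurableSet_biInter _ fun j _ => measurable_pi_apply _ ?_
  split_ifs
  exacts [measurableSet_Iic, measurableSet_Ici]

lemma prod_range_ite_even {M : Type*} [CommMonoid M] (a b : M) (n : ℕ) :
    ∏ j ∈ Finset.range (2 * n + 1), (if Even j then a else b) = b ^ n * a ^ (n + 1) := by
  induction n with
  | zero => simp
  | succ n ih =>
    rw [show 2 * (n + 1) + 1 = 2 * n + 1 + 1 + 1 by ring, Finset.prod_range_succ,
      Finset.prod_range_succ, ih, if_neg (by simp), if_pos ⟨n + 1, by ring⟩, pow_succ b,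
      pow_succ a (n + 1)]
    simp only [mul_assoc, mul_comm, mul_left_comm]

lemma iidLaw_alternatingEvent (μ : Measure ℝ) [IsProbabilityMeasure μ] (n : ℕ) (ε : ℝ) (i : ℕ) :
    (iidLaw μ).real (alternatingEvent (fun j x => x j) n ε i) = alternatingProb μ n ε := by
  have h : iIndepFun (fun (j : ℕ) (x : ℕ → ℝ) => x (i + j)) (iidLaw μ) :=
    (iIndepFun_infinitePi (X := fun _ x => x) fun _ => measurable_id).precomp
      (add_right_injective i)
  rw [alternatingEvent_eq_biInter, measureReal_def,
    h.measure_inter_preimage_eq_mul _ (fun j _ => by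
      split_ifs
      exacts [measurableSet_Iic, measurableSet_Ici])]
  have h2 : ∀ j, iidLaw μ ((fun x : ℕ → ℝ => x (i + j)) ⁻¹'
      (if Even j then Iic (n * ε) else Ici ((n + 1) * ε))) =
      if Even j then μ (Iic (n * ε)) else μ (Ici ((n + 1) * ε)) := by
    intro j
    have := measurePreserving_eval_infinitePi (fun _ : ℕ => μ) (i + j)
    split_ifs
    · exact this.measure_preimage measurableSet_Iic.nullMeasurableSet
    · exact this.measure_preimage measurableSet_Ici.nullMeasurableSet
  simp only [h2, prod_range_ite_even, ENNReal.toReal_mul, ENNReal.toReal_pow]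
  rfl

lemma IsAdmissible.alternatingProb_pos {μ : Measure ℝ} [IsProbabilityMeasure μ] {n : ℕ} {ε : ℝ}
    (h : IsAdmissible μ n ε) : 0 < alternatingProb μ n ε :=
  mul_pos (pow_pos (ENNReal.toReal_pos h.upper.ne' (measure_ne_top _ _)) _)
    (pow_pos (ENNReal.toReal_pos h.lower.ne' (measure_ne_top _ _)) _)

lemma alternatingProb_le_one (μ : Measure ℝ) [IsProbabilityMeasure μ] (n : ℕ) (ε : ℝ) :
    alternatingProb μ n ε ≤ 1 := by
  rw [← iidLaw_alternatingEvent μ n ε 0]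
  exact measureReal_le_one

lemma IsIIDInput.real_alternatingEvent {Ω : Type*} [MeasurableSpace Ω] {P : Measure Ω}
    {μ : Measure ℝ} [IsProbabilityMeasure μ] {X : ℕ → Ω → ℝ} (h : IsIIDInput P μ X) (n : ℕ) (ε : ℝ)
    {i : ℕ} (hi : 2 ≤ i) : P.real (alternatingEvent X n ε i) = alternatingProb μ n ε := by
  obtain ⟨i, rfl⟩ := Nat.exists_eq_add_of_le' hi
  rw [← iidLaw_alternatingEvent μ n ε i,
    ← h.measurePreserving.measureReal_preimage
      (measurableSet_alternatingEvent n ε i).nullMeasurableSet]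
  congr 1
  ext ω
  exact mem_alternatingEvent_add_two

lemma alternatingEvent_dropSeq {n : ℕ} {ε : ℝ} {i N : ℕ} {x : ℕ → ℝ} :
    dropSeq N x ∈ alternatingEvent (fun j x => x j) n ε i ↔
      x ∈ alternatingEvent (fun j x => x j) n ε (i + N) := by
  have h1 : ∀ k, i + 2 * k + N = i + N + 2 * k := fun k => by omega
  have h2 : ∀ k, i + 2 * k + 1 + N = i + N + 2 * k + 1 := fun k => by omega
  simp only [alternatingEvent, mem_ofPred_eq, dropSeq, h1, h2]

/-- Alternating events over disjoint blocks are independent. -/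
lemma iidLaw_forall_notMem_alternatingEvent (μ : Measure ℝ) [IsProbabilityMeasure μ] (n : ℕ)
    (ε : ℝ) (k : ℕ) :
    (iidLaw μ).real {x | ∀ j < k, x ∉ alternatingEvent (fun j x => x j) n ε ((2 * n + 1) * j)} =
      (1 - alternatingProb μ n ε) ^ k := by
  induction k with
  | zero => simp
  | succ k ih =>
    set A : Set (ℕ → ℝ) :=
      {x | ∀ j < k, x ∉ alternatingEvent (fun j x => x j) n ε ((2 * n + 1) * j)} with hA
    have hAm : MeasurableSet A := by
      have : A = ⋂ j ∈ Finset.range k,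
          (alternatingEvent (fun j x => x j) n ε ((2 * n + 1) * j))ᶜ := by
        ext; simp [hA]
      rw [this]
      exact Finset.measurableSet_biInter _ fun j _ => (measurableSet_alternatingEvent _ _ _).compl
    set B : Set (Fin (2 * n + 1) → ℝ) := ⋂ j : Fin (2 * n + 1),
      (fun y : Fin (2 * n + 1) → ℝ => y j) ⁻¹'
        (if Even (j : ℕ) then Iic (n * ε) else Ici ((n + 1) * ε)) with hB
    have hBm : MeasurableSet B := MeasurableSet.iInter fun j => measurable_pi_apply j (by
      split_ifs
      exacts [measurableSet_Iic, measurableSet_Ici])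
    have hBE : alternatingEvent (fun j (x : ℕ → ℝ) => x j) n ε 0 =
        (fun (x : ℕ → ℝ) (i : Fin (2 * n + 1)) => x i) ⁻¹' B := by
      rw [alternatingEvent_eq_biInter, hB]
      ext x
      simp only [mem_iInter, Finset.mem_range, mem_preimage, zero_add]
      exact ⟨fun h j => h j j.2, fun h j hj => h ⟨j, hj⟩⟩
    have hsplit : {x | ∀ j < k + 1,
          x ∉ alternatingEvent (fun j x => x j) n ε ((2 * n + 1) * j)} =
        (fun (x : ℕ → ℝ) (i : Fin (2 * n + 1)) => x i) ⁻¹' Bᶜ ∩ dropSeq (2 * n + 1) ⁻¹' A := by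
      ext x
      rw [preimage_compl, ← hBE]
      simp only [mem_ofPred_eq, mem_inter_iff, mem_compl_iff, mem_preimage, hA,
        alternatingEvent_dropSeq]
      constructor
      · intro h
        exact ⟨h 0 (by omega), fun j hj => h (j + 1) (by omega)⟩
      · rintro ⟨h0, h⟩ (_ | j) hj
        exacts [h0, h j (by omega)]
    -- The first block involves only the first `2n+1` entries, and the other `k` blocks only the
    -- shifted sequence.
    rw [hsplit, measureReal_def,
      (indepFun_take_dropSeq μ (2 * n + 1)).measure_inter_preimage_eq_mul _ _ hBm.compl hAm,
      ENNReal.toReal_mul, preimage_compl, ← hBE,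
      (measurePreserving_dropSeq μ _).measure_preimage hAm.nullMeasurableSet]
    change (iidLaw μ).real _ * (iidLaw μ).real A = _
    rw [ih, probReal_compl_eq_one_sub (measurableSet_alternatingEvent n ε 0),
      iidLaw_alternatingEvent, pow_succ']

/-- Geometric tail of the hitting time. -/
lemma IsIIDInput.real_le_hittingTimeE_le {Ω : Type*} [MeasurableSpace Ω] {P : Measure Ω}
    [IsProbabilityMeasure P]
    {μ : Measure ℝ} [IsProbabilityMeasure μ] {X : ℕ → Ω → ℝ} (h : IsIIDInput P μ X)
    {n : ℕ} (hn : 1 ≤ n) (ε : ℝ) (k : ℕ) :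
    P.real {ω | (((2 * n + 1) * k : ℕ) : ℕ∞) ≤ hittingTimeE X n ε ω} ≤
      (1 - alternatingProb μ n ε) ^ k := by
  rw [← iidLaw_forall_notMem_alternatingEvent, measureReal_def, measureReal_def]
  refine ENNReal.toReal_mono (measure_ne_top _ _) ?_
  refine (measure_mono ?_).trans (h.measurePreserving.measure_preimage_le _)
  -- A block at `(2n+1)j` with `j < k` puts the hitting time at or below `(2n+1)j + 2`, which is
  -- less than `(2n+1)k` because `n ≥ 1`.
  intro ω hω j hj hE
  have h1 := hittingTimeE_le_iff.2
    ⟨_, Nat.le_add_left _ _, le_rfl, mem_alternatingEvent_add_two.2 hE⟩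
  have h2 : (2 * n + 1) * k ≤ (2 * n + 1) * j + 2 := by
    exact_mod_cast (show _ ≤ hittingTimeE X n ε ω from hω).trans h1
  have h3 : (2 * n + 1) * (j + 1) ≤ (2 * n + 1) * k := Nat.mul_le_mul_left _ hj
  rw [mul_add] at h3
  omega

lemma IsIIDInput.ae_couplingTime_lt_top {Ω : Type*} [MeasurableSpace Ω] {P : Measure Ω}
    [IsProbabilityMeasure P]
    {μ : Measure ℝ} [IsProbabilityMeasure μ] {X : ℕ → Ω → ℝ} (h : IsIIDInput P μ X)
    {n : ℕ} {ε : ℝ} (hadm : IsAdmissible μ n ε) : ∀ᵐ ω ∂P, couplingTime X n ε ω < ⊤ := by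
  have hlim := tendsto_pow_atTop_nhds_zero_of_lt_one
    (sub_nonneg.2 (alternatingProb_le_one μ n ε)) (sub_lt_self 1 hadm.alternatingProb_pos)
  have hle : P.real {ω | hittingTimeE X n ε ω = ⊤} ≤ 0 := by
    refine ge_of_tendsto' hlim fun k => le_trans (measureReal_mono ?_)
      (h.real_le_hittingTimeE_le hadm.one_le ε k)
    intro ω (hω : _ = _)
    simp [hω]
  have h0 : P {ω | hittingTimeE X n ε ω = ⊤} = 0 :=
    (measureReal_eq_zero_iff).1 (le_antisymm hle measureReal_nonneg)
  filter_upwards [measure_eq_zero_iff_ae_notMem.1 h0] with ω hω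
  rw [couplingTime]
  exact ENat.add_lt_top.2 ⟨lt_top_iff_ne_top.2 hω, ENat.natCast_lt_top _⟩

/-- The coupling time has geometric tails. -/
lemma exists_geometric_tail {μ : Measure ℝ} [IsProbabilityMeasure μ]
    {n : ℕ} {ε : ℝ} (hadm : IsAdmissible μ n ε) :
    ∃ C ρ : ℝ, 0 < C ∧ 0 < ρ ∧ ρ < 1 ∧
      ∀ (Ω : Type u) [MeasurableSpace Ω] (P : Measure Ω) [IsProbabilityMeasure P]
        (X : ℕ → Ω → ℝ), IsIIDInput P μ X → ∀ m : ℕ,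
        P.real {ω | (m : ℕ∞) < couplingTime X n ε ω} ≤ C * ρ ^ m := by
  -- The maximum with `1/2` keeps `r` positive for real powers without excluding `q = 1`.
  set r : ℝ := max (1 - alternatingProb μ n ε) (1 / 2)
  have hr0 : 0 < r := lt_max_of_lt_right (by norm_num)
  have hr1 : r < 1 := max_lt (sub_lt_self 1 hadm.alternatingProb_pos) (by norm_num)
  have hN : (0 : ℝ) < 2 * n + 1 := by positivity
  refine ⟨r ^ (-2 : ℝ), r ^ (1 / (2 * (n : ℝ) + 1)), by positivity, by positivity,
    Real.rpow_lt_one hr0.le hr1 (by positivity), fun Ω _ P _ X hX m => ?_⟩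
  -- One block length is given up to absorb the `2n` between hitting and coupling time; rounding
  -- down costs at most one more, whence the factor `r ^ (-2)`. If the subtraction yields `0`, the
  -- bound is trivial.
  set k := m / (2 * n + 1) - 1
  have hk : (m : ℝ) / (2 * n + 1) - 2 ≤ k := by
    have h1 : m ≤ (2 * n + 1) * (k + 2) := by
      have h2 := Nat.div_add_mod m (2 * n + 1)
      have h3 := Nat.mod_lt m (show 0 < 2 * n + 1 by omega)
      have h4 : (2 * n + 1) * (m / (2 * n + 1) + 1) ≤ (2 * n + 1) * (k + 2) :=
        Nat.mul_le_mul_left _ (by omega)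
      rw [mul_add] at h4
      omega
    have h5 : (m : ℝ) ≤ (2 * n + 1) * (k + 2) := by exact_mod_cast h1
    rw [sub_le_iff_le_add, div_le_iff₀ hN]
    linarith
  have hrhs : r ^ k ≤ r ^ (-2 : ℝ) * (r ^ (1 / (2 * (n : ℝ) + 1))) ^ m := by
    rw [← Real.rpow_natCast, ← Real.rpow_natCast, ← Real.rpow_mul hr0.le, ← Real.rpow_add hr0]
    refine Real.rpow_le_rpow_of_exponent_ge hr0 hr1.le ?_
    rw [one_div_mul_eq_div]
    linarith
  refine le_trans ?_ hrhs
  rcases Nat.eq_zero_or_pos k with h0 | hpos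
  · rw [h0, pow_zero]
    exact measureReal_le_one
  refine (measureReal_mono ?_).trans ((hX.real_le_hittingTimeE_le hadm.one_le ε k).trans
    (pow_le_pow_left₀ (sub_nonneg.2 (alternatingProb_le_one μ n ε)) (le_max_left _ _) k))
  intro ω hω
  by_contra hlt
  refine absurd (show (m : ℕ∞) < couplingTime X n ε ω from hω) (not_lt.2 ?_)
  have h1 : (2 * n + 1) * (k + 1) ≤ m := by
    rw [show k + 1 = m / (2 * n + 1) by omega]
    exact Nat.mul_div_le _ _
  have h2 : hittingTimeE X n ε ω ≤ (((2 * n + 1) * k : ℕ) : ℕ∞) := (not_le.1 hlt).le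
  calc couplingTime X n ε ω ≤ (((2 * n + 1) * k : ℕ) : ℕ∞) + ((2 * n : ℕ) : ℕ∞) := by
        unfold couplingTime
        gcongr
    _ ≤ m := by
        rw [mul_add] at h1
        exact_mod_cast (by omega : (2 * n + 1) * k + 2 * n ≤ m)

/-! ### Existence of admissible pairs -/

lemma exists_isAdmissible {μ : Measure ℝ} [IsProbabilityMeasure μ] (hμ : μ (Iio 0) = 0)
    (hne : ∀ c : ℝ, μ ≠ Measure.dirac c) : ∃ (n : ℕ) (ε : ℝ), IsAdmissible μ n ε := by
  obtain ⟨c, hc⟩ := Measure.nonempty_support (IsProbabilityMeasure.ne_zero μ)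
  obtain ⟨d, hd, hcd⟩ : ∃ d ∈ μ.support, d ≠ c := by
    by_contra! hall
    have hae : id =ᵐ[μ] fun _ => c := by
      filter_upwards [Measure.support_mem_ae] with x hx using hall x hx
    refine hne c ?_
    rw [← Measure.map_id (μ := μ), Measure.map_congr hae, Measure.map_const, measure_univ,
      one_smul]
  wlog h : c < d generalizing c d
  · exact this d hd c hc hcd.symm (lt_of_le_of_ne (not_lt.1 h) hcd)
  rw [Measure.mem_support_iff_forall] at hc hd
  -- Five steps suffice: with `n = ⌈(c + δ)/δ⌉ + 1`, one has `c + δ ≤ nδ` and `(n + 1)δ < c + 4δ = d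
  -- - δ`.
  set δ := (d - c) / 5 with hδ
  have hδ0 : 0 < δ := by linarith
  have hlow : 0 < μ (Iic (c + δ)) := hc _ (Iic_mem_nhds (by linarith))
  have hup : 0 < μ (Ici (d - δ)) := hd _ (Ici_mem_nhds (by linarith))
  -- Nonnegativity of the input enters here, so that the natural-number ceiling does not overshoot.
  have hpos : 0 ≤ c + δ := by
    by_contra! hneg
    exact hlow.ne' (measure_mono_null (fun x hx => lt_of_le_of_lt hx hneg) hμ)
  have h1 := Nat.le_ceil ((c + δ) / δ)
  have h2 := Nat.ceil_lt_add_one (div_nonneg hpos hδ0.le)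
  rw [div_le_iff₀ hδ0] at h1
  rw [← sub_lt_iff_lt_add, lt_div_iff₀ hδ0] at h2
  refine ⟨⌈(c + δ) / δ⌉₊ + 1, δ, by omega, hδ0, ?_, ?_⟩
  · refine hup.trans_le (measure_mono (Ici_subset_Ici.2 ?_))
    push_cast
    linarith
  · refine hlow.trans_le (measure_mono (Iic_subset_Iic.2 ?_))
    push_cast
    linarith

/-! ### Tightness -/

/-- After the first step the state lies between `0` and the latest input, whose law is always `μ`;
the initial law is a single tight measure. -/
lemma IsWaitingProcess.isTightMeasureSet {Ω : Type*} [MeasurableSpace Ω] {P : Measure Ω}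
    [IsProbabilityMeasure P] {μ : Measure ℝ} [IsProbabilityMeasure μ] {X W : ℕ → Ω → ℝ}
    (h : IsWaitingProcess P X W) (hX : IsIIDInput P μ X) :
    IsTightMeasureSet {ν : Measure ℝ | ∃ m, 1 ≤ m ∧ ν = P.map (W m)} := by
  have h1 : IsTightMeasureSet {P.map (W 1)} := isTightMeasureSet_singleton
  have h2 : IsTightMeasureSet {ν : Measure ℝ | ∃ m, 1 ≤ m ∧ ν = P.map (W (m + 1))} := by
    rw [isTightMeasureSet_iff_exists_isCompact_measure_compl_le]
    intro δ hδ
    obtain ⟨K, hK, hKμ⟩ := isTightMeasureSet_iff_exists_isCompact_measure_compl_le.1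
      (isTightMeasureSet_singleton (μ := μ)) δ hδ
    obtain ⟨b, hb⟩ := hK.bddAbove
    refine ⟨Icc 0 (max 0 b), isCompact_Icc, ?_⟩
    rintro _ ⟨m, hm, rfl⟩
    rw [Measure.map_apply (h.measurable hX (by omega)) measurableSet_Icc.compl]
    refine le_trans ?_ (hKμ μ rfl)
    rw [← hX.law (m + 1) (by omega)]
    have hle : P (X (m + 1) ⁻¹' Kᶜ) ≤ P.map (X (m + 1)) Kᶜ :=
      Measure.le_map_apply (hX.measurable _ (by omega)).aemeasurable _
    refine le_trans (measure_mono_ae ?_) hle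
    filter_upwards [h.nonneg_init] with ω hω hmem hXK
    refine hmem ⟨h.nonneg hω (by omega), ?_⟩
    rw [h.recursion m hm]
    exact max_le_max le_rfl ((sub_le_self _ (h.nonneg hω hm)).trans (hb hXK))
  refine (h1.union h2).subset ?_
  rintro _ ⟨m, hm, rfl⟩
  rcases hm.eq_or_lt with rfl | hlt
  · exact Or.inl rfl
  · exact Or.inr ⟨m - 1, by omega, by rw [Nat.sub_add_cancel hm]⟩

/-! ### Stationary laws -/

lemma IsStationaryLaw.ae_nonneg {μ π : Measure ℝ} (h : IsStationaryLaw μ π) :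
    ∀ᵐ w ∂π, 0 ≤ w := by
  rw [← h.map_eq]
  exact (ae_map_iff (by fun_prop) measurableSet_Ici).2 (ae_of_all _ fun _ => le_max_left _ _)

/-- A constant input admits no admissible pair; instead `c / 2` is a fixed point of `w ↦ c - w`. -/
lemma isStationaryLaw_dirac {c : ℝ} (hc : 0 ≤ c) :
    IsStationaryLaw (Measure.dirac c) (Measure.dirac (c / 2)) where
  isProbabilityMeasure := inferInstance
  map_eq := by
    rw [Measure.dirac_prod_dirac, Measure.map_dirac' (by fun_prop)]
    simp only [sub_half]
    rw [max_eq_right (by positivity)]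

/-- The almost sure limit of the backward iterations has a stationary law. -/
lemma IsAdmissible.exists_isStationaryLaw {μ : Measure ℝ} [IsProbabilityMeasure μ] {n : ℕ} {ε : ℝ}
    (hadm : IsAdmissible μ n ε) : ∃ π, IsStationaryLaw μ π := by
  have hlim : ∀ᵐ x ∂(iidLaw μ), ∃ l, Filter.Tendsto (fun m => backwardIter m x) Filter.atTop
      (nhds l) := by
    filter_upwards [(isIIDInput_iidLaw μ).ae_couplingTime_lt_top hadm] with x hx
    obtain ⟨k, hk⟩ := ENat.ne_top_iff_exists.1 hx.ne
    obtain ⟨ℓ, h2, -, hE⟩ := couplingTime_le_iff.1 hk.ge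
    obtain ⟨i, rfl⟩ := Nat.exists_eq_add_of_le' h2
    refine ⟨backwardIter i x, tendsto_const_nhds.congr' ?_⟩
    filter_upwards [Filter.eventually_ge_atTop (i + (2 * n + 1))] with m hm
    exact (backwardIter_eq_of_alternating hadm.pos (mem_alternatingEvent_add_two.1 hE) hm).symm
  obtain ⟨V, hVm, hV⟩ := measurable_limit_of_tendsto_metrizable_ae
    (fun m => (measurable_backwardIter m).aemeasurable) hlim
  have hV' := (measurePreserving_dropSeq μ 1).quasiMeasurePreserving.ae hV
  -- The backward recursion passes to the limit; here `V (dropSeq 1 x)` has the law of `V` and is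
  -- independent of `x 0`.
  have hfix : (fun x => max 0 (x 0 - V (dropSeq 1 x))) =ᵐ[iidLaw μ] V := by
    filter_upwards [hV, hV'] with x hx hx'
    refine tendsto_nhds_unique ?_ ((Filter.tendsto_add_atTop_iff_nat 1).2 hx)
    simp only [backwardIter_succ]
    exact tendsto_const_nhds.max (tendsto_const_nhds.sub hx')
  refine ⟨(iidLaw μ).map V, Measure.isProbabilityMeasure_map hVm.aemeasurable, ?_⟩
  have hprod : ((iidLaw μ).map V).prod μ = (iidLaw μ).map (fun x => (V (dropSeq 1 x), x 0)) := by
    have h1 : MeasurePreserving V (iidLaw μ) ((iidLaw μ).map V) := hVm.measurePreserving _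
    have : IsProbabilityMeasure ((iidLaw μ).map V) :=
      Measure.isProbabilityMeasure_map hVm.aemeasurable
    exact ((h1.prod (MeasurePreserving.id μ)).comp
      (measurePreserving_dropSeq_one_prodMk μ)).map_eq.symm
  rw [hprod, Measure.map_map (by fun_prop) (by fun_prop)]
  exact Measure.map_congr hfix

lemma IsStationaryLaw.measurePreserving_forwardIter {μ π : Measure ℝ} [IsProbabilityMeasure μ]
    (h : IsStationaryLaw μ π) (m : ℕ) :
    MeasurePreserving (fun p : (ℕ → ℝ) × ℝ => forwardIter m p.1 p.2) ((iidLaw μ).prod π) π := by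
  have := h.isProbabilityMeasure
  have hg : MeasurePreserving (fun p : ℝ × ℝ => max 0 (p.2 - p.1)) (π.prod μ) π :=
    ⟨by fun_prop, h.map_eq⟩
  -- Split off `x 0`, pair it with the state, and apply stationarity to that pair.
  have hstep : MeasurePreserving
      (fun p : (ℕ → ℝ) × ℝ => (dropSeq 1 p.1, max 0 (p.1 0 - p.2)))
      ((iidLaw μ).prod π) ((iidLaw μ).prod π) :=
    ((MeasurePreserving.id (iidLaw μ)).prod (hg.comp Measure.measurePreserving_swap)).comp
      ((measurePreserving_prodAssoc (iidLaw μ) μ π).comp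
        ((measurePreserving_dropSeq_one_prodMk μ).prod (MeasurePreserving.id π)))
  induction m with
  | zero => exact measurePreserving_snd
  | succ m ih => exact ih.comp hstep

/-! ### Coupling inequality and uniqueness -/

open scoped symmDiff in
/-- The coupling inequality. -/
lemma IsStationaryLaw.abs_sub_le {μ π : Measure ℝ} [IsProbabilityMeasure μ]
    (h : IsStationaryLaw μ π) {ε : ℝ} (hε : 0 < ε) (n : ℕ)
    {Ω : Type*} [MeasurableSpace Ω] {P : Measure Ω}
    [IsProbabilityMeasure P] {X W : ℕ → Ω → ℝ} (hX : IsIIDInput P μ X)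
    (hW : IsWaitingProcess P X W) {m : ℕ} (hm : 1 ≤ m) {A : Set ℝ} (hA : MeasurableSet A) :
    |(P.map (W m)).real A - π.real A| ≤ P.real {ω | (m : ℕ∞) < couplingTime X n ε ω} := by
  have := h.isProbabilityMeasure
  have hWm := hW.measurable hX hm
  -- On `P.prod π` the second coordinate is a stationary start independent of the inputs and of `W
  -- 1`; both processes use the same inputs.
  have h1 : MeasurePreserving (fun p : Ω × ℝ => W m p.1) (P.prod π) (P.map (W m)) :=
    (hWm.measurePreserving P).comp measurePreserving_fst
  have h2 : MeasurePreserving (fun p : Ω × ℝ => forwardIter (m - 1) (inputSeq X p.1) p.2)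
      (P.prod π) π :=
    (h.measurePreserving_forwardIter (m - 1)).comp
      (hX.measurePreserving.prod (MeasurePreserving.id π))
  rw [← h1.measureReal_preimage hA.nullMeasurableSet, ← h2.measureReal_preimage hA.nullMeasurableSet]
  refine (abs_measureReal_sub_le_measureReal_symmDiff (h1.measurable hA).nullMeasurableSet
    (h2.measurable hA).nullMeasurableSet).trans ?_
  have hU : P.real {ω | (m : ℕ∞) < couplingTime X n ε ω} =
      (P.prod π).real ({ω | (m : ℕ∞) < couplingTime X n ε ω} ×ˢ univ) := by
    rw [measureReal_def, measureReal_def, Measure.prod_prod, measure_univ, mul_one]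
  rw [hU]
  refine ENNReal.toReal_mono (measure_ne_top _ _) (measure_mono_ae ?_)
  filter_upwards [Measure.quasiMeasurePreserving_fst.ae hW.nonneg_init,
    Measure.quasiMeasurePreserving_snd.ae h.ae_nonneg] with p hp1 hp2 hp
  by_contra hc
  have hle : couplingTime X n ε p.1 ≤ m := not_lt.1 fun hlt => hc ⟨hlt, trivial⟩
  have heq := forwardIter_eq_of_couplingTime_le hε hp1 hp2 hle
  rw [← hW.eq_forwardIter, Nat.sub_add_cancel hm] at heq
  have hiff : W m p.1 ∈ A ↔ forwardIter (m - 1) (inputSeq X p.1) p.2 ∈ A := by rw [heq]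
  rcases hp with ⟨ha, hb⟩ | ⟨ha, hb⟩
  exacts [hb (hiff.1 ha), hb (hiff.2 ha)]

/-- The waiting-time process on sequence space started from `0`. -/
lemma isWaitingProcess_forwardIter (μ : Measure ℝ) :
    IsWaitingProcess (iidLaw μ) (fun i x => x (i - 2)) (fun m x => forwardIter (m - 1) x 0) where
  measurable_init := measurable_const
  nonneg_init := ae_of_all _ fun _ => le_rfl
  recursion n hn x := by
    obtain ⟨n, rfl⟩ := Nat.exists_eq_add_of_le' hn
    exact forwardIter_succ n x 0

/-- The laws of the process started from `0` converge on every Borel set to each of the two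
stationary laws. -/
lemma IsAdmissible.eq_of_isStationaryLaw {μ π π' : Measure ℝ} [IsProbabilityMeasure μ]
    {n : ℕ} {ε : ℝ} (hadm : IsAdmissible μ n ε) (h : IsStationaryLaw μ π)
    (h' : IsStationaryLaw μ π') : π' = π := by
  have := h.isProbabilityMeasure
  have := h'.isProbabilityMeasure
  obtain ⟨C, ρ, -, hρ0, hρ1, hC⟩ := exists_geometric_tail.{0} hadm
  have hlim : Filter.Tendsto (fun m : ℕ => C * ρ ^ m) Filter.atTop (nhds 0) := by
    simpa using (tendsto_pow_atTop_nhds_zero_of_lt_one hρ0.le hρ1).const_mul C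
  have hX := isIIDInput_iidLaw μ
  have key : ∀ {ν : Measure ℝ}, IsStationaryLaw μ ν → ∀ {A : Set ℝ}, MeasurableSet A →
      Filter.Tendsto (fun m : ℕ => ((iidLaw μ).map (fun x => forwardIter (m - 1) x 0)).real A)
        Filter.atTop (nhds (ν.real A)) := by
    intro ν hν A hA
    rw [tendsto_iff_norm_sub_tendsto_zero]
    refine squeeze_zero' (Filter.Eventually.of_forall fun _ => norm_nonneg _) ?_ hlim
    filter_upwards [Filter.eventually_ge_atTop 1] with m hm
    exact (hν.abs_sub_le hadm.pos n hX (isWaitingProcess_forwardIter μ) hm hA).trans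
      (hC _ _ _ hX m)
  refine Measure.ext fun A hA => ?_
  have heq := tendsto_nhds_unique (key h' hA) (key h hA)
  exact (ENNReal.toReal_eq_toReal_iff' (measure_ne_top _ _) (measure_ne_top _ _)).1 heq

theorem mainTheorem4 (μ : Measure ℝ) [IsProbabilityMeasure μ] (hμ : μ (Iio 0) = 0) :
    -- existence of an equilibrium law, and tightness of the laws of the process
    (∃ π : Measure ℝ, IsStationaryLaw μ π) ∧
    (∀ (Ω : Type u) [MeasurableSpace Ω] (P : Measure Ω) [IsProbabilityMeasure P]
      (X W : ℕ → Ω → ℝ), IsIIDInput P μ X → IsWaitingProcess P X W →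
      IsTightMeasureSet {ν : Measure ℝ | ∃ m, 1 ≤ m ∧ ν = P.map (W m)}) ∧
    -- the case of a non-deterministic input
    ((∀ c : ℝ, μ ≠ Measure.dirac c) →
      ∃ π : Measure ℝ, IsStationaryLaw μ π ∧
        -- uniqueness of the equilibrium law
        (∀ π' : Measure ℝ, IsStationaryLaw μ π' → π' = π) ∧
        -- geometric convergence in total variation, uniformly in the initial state
        (∃ C ρ : ℝ, 0 < C ∧ 0 < ρ ∧ ρ < 1 ∧
          ∀ (Ω : Type u) [MeasurableSpace Ω] (P : Measure Ω) [IsProbabilityMeasure P]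
            (X W : ℕ → Ω → ℝ), IsIIDInput P μ X → IsWaitingProcess P X W →
            ∀ m, 1 ≤ m → ∀ A : Set ℝ, MeasurableSet A →
              |(P.map (W m)).real A - π.real A| ≤ C * ρ ^ m) ∧
        -- the coupling
        (∃ (n : ℕ) (ε : ℝ), IsAdmissible μ n ε) ∧
        (∀ (n : ℕ) (ε : ℝ), IsAdmissible μ n ε →
          ∀ (Ω : Type u) [MeasurableSpace Ω] (P : Measure Ω) [IsProbabilityMeasure P]
            (X : ℕ → Ω → ℝ), IsIIDInput P μ X →
            -- probability of the event, and geometric tail of its hitting time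
            (∀ i, 2 ≤ i → P.real (alternatingEvent X n ε i) = alternatingProb μ n ε) ∧
            0 < alternatingProb μ n ε ∧
            (∀ k : ℕ, 1 ≤ k →
              P.real {ω | (((2 * n + 1) * k : ℕ) : ℕ∞) ≤ hittingTimeE X n ε ω}
                ≤ (2 * (n : ℝ) + 1) * (1 - alternatingProb μ n ε) ^ k) ∧
            (∀ᵐ ω ∂P, couplingTime X n ε ω < ⊤) ∧
            -- two processes with the same input vanish at the coupling time and coincide from then
            (∀ W W' : ℕ → Ω → ℝ, IsWaitingProcess P X W → IsWaitingProcess P X W' →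
              ∀ᵐ ω ∂P, ∀ m : ℕ,
                (couplingTime X n ε ω = m → W m ω = 0 ∧ W' m ω = 0) ∧
                (couplingTime X n ε ω ≤ m → W m ω = W' m ω)) ∧
            -- the distance to equilibrium is bounded by the tail of the coupling time
            (∀ W : ℕ → Ω → ℝ, IsWaitingProcess P X W →
              ∀ m : ℕ, 1 ≤ m → ∀ A : Set ℝ, MeasurableSet A →
                |(P.map (W m)).real A - π.real A| ≤
                  P.real {ω | (m : ℕ∞) < couplingTime X n ε ω}))) := by
  have hexist : (∀ c : ℝ, μ ≠ Measure.dirac c) → ∃ π, IsStationaryLaw μ π := fun hne => by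
    obtain ⟨n, ε, hadm⟩ := exists_isAdmissible hμ hne
    exact hadm.exists_isStationaryLaw
  refine ⟨?_, fun Ω _ P _ X W hX hW => hW.isTightMeasureSet hX, fun hne => ?_⟩
  · by_cases hne : ∀ c : ℝ, μ ≠ Measure.dirac c
    · exact hexist hne
    · push Not at hne
      obtain ⟨c, rfl⟩ := hne
      refine ⟨_, isStationaryLaw_dirac (not_lt.1 fun hc => ?_)⟩
      rw [Measure.dirac_apply' _ measurableSet_Iio, indicator_of_mem (mem_Iio.2 hc)] at hμ
      exact one_ne_zero hμ
  obtain ⟨π, hπ⟩ := hexist hne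
  obtain ⟨n₀, ε₀, hadm₀⟩ := exists_isAdmissible hμ hne
  refine ⟨π, hπ, fun π' hπ' => hadm₀.eq_of_isStationaryLaw hπ hπ', ?_, ⟨n₀, ε₀, hadm₀⟩, ?_⟩
  · obtain ⟨C, ρ, hC0, hρ0, hρ1, hC⟩ := exists_geometric_tail.{u} hadm₀
    exact ⟨C, ρ, hC0, hρ0, hρ1, fun Ω _ P _ X W hX hW m hm A hA =>
      (hπ.abs_sub_le hadm₀.pos n₀ hX hW hm hA).trans (hC Ω P X hX m)⟩
  intro n ε hadm Ω _ P _ X hX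
  refine ⟨fun i hi => hX.real_alternatingEvent n ε hi, hadm.alternatingProb_pos, fun k _ => ?_,
    hX.ae_couplingTime_lt_top hadm, fun W W' hW hW' => ?_,
    fun W hW m hm A hA => hπ.abs_sub_le hadm.pos n hX hW hm hA⟩
  -- The bound already holds without the factor `2n+1`.
  · refine (hX.real_le_hittingTimeE_le hadm.one_le ε k).trans (le_mul_of_one_le_left ?_ ?_)
    · exact pow_nonneg (sub_nonneg.2 (alternatingProb_le_one μ n ε)) k
    · linarith [(Nat.cast_nonneg n : (0 : ℝ) ≤ n)]
  · filter_upwards [hW.nonneg_init, hW'.nonneg_init] with ω h1 h1' m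
    exact ⟨fun hm => ⟨hW.eq_zero_of_couplingTime_eq hadm.pos h1 hm,
      hW'.eq_zero_of_couplingTime_eq hadm.pos h1' hm⟩,
      fun hm => hW.eq_of_couplingTime_le hW' hadm.pos h1 h1' hm⟩
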